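/- Let $X$ be a real finite-dimensional normed space with $\dim X\ge 2$ and closed unit ball $B_X$, and assume that $X$ is polyhedral, i.e. the set $\mathrm{Ext}\,B_X$ of extreme points of $B_X$ is finite. For $x\neq 0$ let $J(x)=\{f\in X^*:\|f\|=1,\ f(x)=\|x\|\}$, and for $f\in \mathrm{Ext}\,B_{X^*}$ let $\mathrm{Sm}(f)=\{x\ne 0: J(x)=\{f\}\}$. Call $(x,y)$ a parallel pair if $\|x+\lambda y\|=\|x\|+\|y\|$ for some $\lambda\in\{1,-1\}$. For $\epsilon\in[0,1)$ write $x\perp_B^{\epsilon}y$ if $\|x+\lambda y\|^2\ge\|x\|^2-2\epsilon\|x\|\|\lambda y\|$ for all $\lambda\in\mathbb R$, and $x\perp_B y$ if $\|x+\lambda y\|\ge\|x\|$ for all $\lambda\in\mathbb R$. A linear operator $T$ on $X$ preserves parallel pairs if $(Tx,Ty)$ is a parallel pair whenever $(x,y)$ is one; it preserves $\epsilon$-orthogonality at $x$ if, for all $y\in X$, $x\perp_B y$ implies $Tx\perp_B^{\epsilon}Ty$. For every pair of linearly independent $\varphi,\psi\in\mathrm{Ext}\,B_{X^*}$ choose $\epsilon_{\varphi\psi}\in(0,1)$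 such that for all $x\in\mathrm{Sm}(\varphi)$ and $y\in\mathrm{Sm}(\psi)$ the set $\{z\in X: x\perp_B^{\epsilon_{\varphi\psi}}z \text{ and } y\perp_B^{\epsilon_{\varphi\psi}}z\}$ contains no subspace of codimension one, and let $\epsilon_X$ be the minimum of the numbers $\epsilon_{\varphi\psi}$. (Such numbers and their minimum exist.) Assume that $|\mathrm{Ext}\,J(u)|>|\mathrm{Ext}\,J(v)|$ for all $u\in\mathrm{Ext}\,B_X$ and all $v\in X$ with $\|v\|=1$ and $v\notin\mathrm{Ext}\,B_X$. Let $T$ be a linear operator on $X$ with $\|T\|=1$. Then, for any choice of the numbers $\epsilon_{\varphi\psi}$ as above, the following are equivalent: (i) $T$ is an isometry; (ii) $T$ is bijective, $T$ preserves parallel pairs, and $\|Tu\|=\|Tv\|$ for all $u,v\in\mathrm{Ext}\,B_X$; (iii) for every $\epsilon$ with $0\le\epsilon<\epsilon_X$, $T$ preserves $\epsilon$-orthogonality at each point of $X$, and $\|Tu\|=\|Tv\|$ for all $u,v\in\mathrm{Ext}\,B_X$; (iii$'$) for some $\epsilon$ with $0\le\epsilon<\epsilon_X$, $T$ preserves $\epsilon$-orthogonality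 at each point of $X$, and $\|Tu\|=\|Tv\|$ for all $u,v\in\mathrm{Ext}\,B_X$. -/

import Mathlib

namespace ParallelPairs

variable {X : Type*} [NormedAddCommGroup X] [NormedSpace ℝ X]

/-- The set `Ext B_X` of extreme points of the closed unit ball of `X`. -/
def extBall (X : Type*) [NormedAddCommGroup X] [NormedSpace ℝ X] : Set X :=
  (Metric.closedBall (0 : X) 1).extremePoints ℝ

/-- A (finite-dimensional) space is polyhedral if its unit ball has finitely many extreme points. -/
def IsPolyhedral (X : Type*) [NormedAddCommGroup X] [NormedSpace ℝ X] : Prop :=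
  (extBall X).Finite

/-- The set `J(x)` of supporting functionals at `x` (used for `x ≠ 0` only). -/
def supp (x : X) : Set (StrongDual ℝ X) :=
  {f | ‖f‖ = 1 ∧ f x = ‖x‖}

/-- `Sm(f)`: the smooth points whose only supporting functional is `f`. -/
def Sm (f : StrongDual ℝ X) : Set X :=
  {x | x ≠ 0 ∧ supp x = {f}}

/-- `(x, y)` is a parallel pair. -/
def IsParallelPair (x y : X) : Prop :=
  ∃ l : ℝ, |l| = 1 ∧ ‖x + l • y‖ = ‖x‖ + ‖y‖

/-- `T` preserves parallel pairs. -/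
def PreservesParallelPairs (T : X →L[ℝ] X) : Prop :=
  ∀ x y : X, IsParallelPair x y → IsParallelPair (T x) (T y)

/-- Birkhoff–James orthogonality of `x` to `y`. -/
def BJOrth (x y : X) : Prop :=
  ∀ l : ℝ, ‖x‖ ≤ ‖x + l • y‖

/-- `ε`-approximate Birkhoff–James orthogonality of `x` to `y`. -/
def ApproxOrth (ε : ℝ) (x y : X) : Prop :=
  ∀ l : ℝ, ‖x‖ ^ 2 - 2 * ε * ‖x‖ * ‖l • y‖ ≤ ‖x + l • y‖ ^ 2

/-- The set of all `y` such that `x` is `ε`-orthogonal to `y`. -/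
def approxOrthSet (ε : ℝ) (x : X) : Set X :=
  {y | ApproxOrth ε x y}

/-- `T` preserves `ε`-orthogonality at `x`. -/
def PreservesApproxOrthAt (ε : ℝ) (T : X →L[ℝ] X) (x : X) : Prop :=
  ∀ y : X, BJOrth x y → ApproxOrth ε (T x) (T y)

/-- `e` is an admissible value of `ε_{φψ}`: it lies in `(0, 1)`, and for all `x ∈ Sm(φ)`,
`y ∈ Sm(ψ)` no hyperspace (maximal proper subspace) is contained in the intersection of the
`e`-orthogonal sets of `x` and `y`. -/
def IsSeparating (e : ℝ) (φ ψ : StrongDual ℝ X) : Prop :=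
  0 < e ∧ e < 1 ∧ ∀ x ∈ Sm φ, ∀ y ∈ Sm ψ, ∀ H : Submodule ℝ X, IsCoatom H →
    ¬ ((H : Set X) ⊆ approxOrthSet e x ∩ approxOrthSet e y)

/-- `c` is a constant `ε_X`: for some choice of admissible numbers `ε_{φψ}`, one for each pair
of linearly independent extreme points `φ, ψ` of the dual unit ball, `c` is their minimum. -/
def IsOrthConst (X : Type*) [NormedAddCommGroup X] [NormedSpace ℝ X] (c : ℝ) : Prop :=
  ∃ e : StrongDual ℝ X → StrongDual ℝ X → ℝ,
    (∀ φ ∈ extBall (StrongDual ℝ X), ∀ ψ ∈ extBall (StrongDual ℝ X),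
      LinearIndependent ℝ ![φ, ψ] → IsSeparating (e φ ψ) φ ψ) ∧
    IsLeast {r : ℝ | ∃ φ ∈ extBall (StrongDual ℝ X), ∃ ψ ∈ extBall (StrongDual ℝ X),
      LinearIndependent ℝ ![φ, ψ] ∧ r = e φ ψ} c

end ParallelPairs

open Filter Topology

namespace ParallelPairs

variable {X : Type*} [NormedAddCommGroup X] [NormedSpace ℝ X]

/-! Each extreme functional `φ` of the dual ball cuts out the cone `φ x = ‖x‖` over a facet of the
unit ball; smooth points are dense in it and form the open set `Sm φ`. The core of the proof is that
(ii) and (iii') each make a bijective `T` send every such cone into a cone of the same kind, up to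
sign.

For parallel pairs this holds because vectors are parallel exactly when, up to sign, they share a
supporting functional. For orthogonality, points of `Sm φ` are orthogonal to `ker φ`, so the
hyperplane `T (ker φ)` lies in the `ε`-orthogonal sets of all their images; below `ε_X` this forces
the functionals supporting the smooth images to agree up to sign. Injectivity in (iii') is proved
separately.

`isometry_of_maps_facets` finishes by counting: facets are permuted, so `Tu` has at least as many
extreme supporting functionals as `u`. The hypothesis on `Ext J` then makes `T` permute the extreme
points of the ball, so the inverse of `T` is also a contraction. -/

theorem neg_mem_extBall {x : X} (hx : x ∈ extBall X) : -x ∈ extBall X := by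
  rw [extBall, mem_extremePoints_iff_left] at hx ⊢
  refine ⟨by simpa using hx.1, fun a ha b hb hab => ?_⟩
  have := hx.2 (-a) (by simpa using ha) (-b) (by simpa using hb) (by
    obtain ⟨s, t, hs, ht, hst, h⟩ := hab
    refine ⟨s, t, hs, ht, hst, ?_⟩
    rw [← neg_inj, ← h]
    module)
  rw [← this, neg_neg]

theorem norm_le_one_of_mem_extBall {x : X} (hx : x ∈ extBall X) : ‖x‖ ≤ 1 := by
  simpa using hx.1

/-- The norm of an operator is controlled by its values at the extreme points of the ball. -/
theorem opNorm_le_of_extBall [FiniteDimensional ℝ X] {Y : Type*} [NormedAddCommGroup Y]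
    [NormedSpace ℝ Y] (T : X →L[ℝ] Y) {k : ℝ} (hk : 0 ≤ k)
    (h : ∀ u ∈ extBall X, ‖T u‖ ≤ k) : ‖T‖ ≤ k := by
  have hsub : Metric.closedBall (0 : X) 1 ⊆ T ⁻¹' Metric.closedBall 0 k := by
    rw [← closure_convexHull_extremePoints (isCompact_closedBall (0 : X) 1)
      (convex_closedBall 0 1)]
    refine closure_minimal (convexHull_min (fun u hu => by simpa using h u hu) ?_)
      (Metric.isClosed_closedBall.preimage T.continuous)
    exact (convex_closedBall (0 : Y) k).linear_preimage T.toLinearMap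
  refine T.opNorm_le_of_unit_norm hk fun x hx => ?_
  simpa using hsub (by simp [hx] : x ∈ Metric.closedBall (0 : X) 1)

/-- In a polyhedral space, an extreme functional is determined by the extreme points at which it
attains the value one. -/
theorem eq_zero_of_vanish_on_active [FiniteDimensional ℝ X] (hpoly : IsPolyhedral X)
    {φ d : StrongDual ℝ X} (hφ : φ ∈ extBall (StrongDual ℝ X))
    (hd : ∀ e ∈ extBall X, φ e = 1 → d e = 0) : d = 0 := by
  have hφ1 := norm_le_one_of_mem_extBall hφ
  -- For small `t`, `φ ± t • d` stays in the dual ball: `d` vanishes where `φ e = ±1`, and the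
  -- finitely many other constraints have slack. Extremality of `φ` then gives `d = 0`.
  have key : ∀ e ∈ extBall X, ∀ᶠ t : ℝ in 𝓝[>] 0, |φ e + t * d e| ≤ 1 ∧ |φ e - t * d e| ≤ 1 := by
    intro e he
    have hle : |φ e| ≤ 1 := by
      simpa using φ.le_of_opNorm_le_of_le hφ1 (norm_le_one_of_mem_extBall he)
    by_cases h0 : d e = 0
    · simp [h0, hle]
    have hlt : |φ e| < 1 := by
      rcases hle.lt_or_eq with h | h
      · exact h
      rcases eq_or_eq_neg_of_abs_eq h with h | h
      · exact absurd (hd e he h) h0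
      · exact absurd (by simpa using hd (-e) (neg_mem_extBall he) (by simp [h])) h0
    refine nhdsWithin_le_nhds (((?_ : ∀ᶠ t : ℝ in 𝓝 0, |φ e + t * d e| < 1).and
      (?_ : ∀ᶠ t : ℝ in 𝓝 0, |φ e - t * d e| < 1)).mono fun t ht => ⟨ht.1.le, ht.2.le⟩)
    · exact (Continuous.tendsto (by fun_prop) (0 : ℝ)).eventually_lt_const (by simpa using hlt)
    · exact (Continuous.tendsto (by fun_prop) (0 : ℝ)).eventually_lt_const (by simpa using hlt)
  obtain ⟨t, ht, ht0⟩ := (((Filter.eventually_all_finite hpoly).2 key).and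
    self_mem_nhdsWithin).exists
  have ht0 : 0 < t := ht0
  have h1 : ‖φ + t • d‖ ≤ 1 := opNorm_le_of_extBall _ zero_le_one fun u hu => by
    simpa using (ht u hu).1
  have h2 : ‖φ - t • d‖ ≤ 1 := opNorm_le_of_extBall _ zero_le_one fun u hu => by
    simpa using (ht u hu).2
  rw [extBall, mem_extremePoints_iff_left] at hφ
  have := hφ.2 (φ + t • d) (by simpa using h1) (φ - t • d) (by simpa using h2)
    ⟨1 / 2, 1 / 2, by norm_num, by norm_num, by norm_num, by module⟩
  simpa [ht0.ne'] using this

/-- The dual of a polyhedral space is polyhedral. -/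
theorem IsPolyhedral.dual [FiniteDimensional ℝ X] (hpoly : IsPolyhedral X) :
    IsPolyhedral (StrongDual ℝ X) := by
  refine Set.Finite.of_finite_image (f := fun φ => {e ∈ extBall X | φ e = 1})
    (hpoly.finite_subsets.subset ?_) ?_
  · rintro _ ⟨φ, -, rfl⟩
    exact Set.sep_subset _ _
  · intro φ hφ ψ hψ h
    refine (sub_eq_zero.1 (eq_zero_of_vanish_on_active hpoly hφ fun e he h1 => ?_)).symm
    have : e ∈ {e ∈ extBall X | ψ e = 1} := by
      rw [← show {e ∈ extBall X | φ e = 1} = {e ∈ extBall X | ψ e = 1} from h]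
      exact ⟨he, h1⟩
    simp [h1, this.2]

/-! ### Supporting functionals -/

theorem apply_le_norm {φ : StrongDual ℝ X} (hφ : ‖φ‖ ≤ 1) (x : X) : φ x ≤ ‖x‖ :=
  (le_abs_self _).trans (by simpa using φ.le_of_opNorm_le hφ x)

theorem supp_eq {x : X} (hx : x ≠ 0) :
    supp x = {f ∈ Metric.closedBall (0 : StrongDual ℝ X) 1 | f x = ‖x‖} := by
  ext f
  simp only [supp, Set.mem_ofPred_eq, mem_closedBall_zero_iff]
  refine ⟨fun h => ⟨h.1.le, h.2⟩, fun h => ⟨le_antisymm h.1 ?_, h.2⟩⟩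
  have h1 := f.le_opNorm x
  rw [h.2, norm_norm] at h1
  exact le_of_mul_le_mul_right (by simpa using h1) (norm_pos_iff.2 hx)

theorem isExtreme_supp {x : X} (hx : x ≠ 0) :
    IsExtreme ℝ (Metric.closedBall (0 : StrongDual ℝ X) 1) (supp x) := by
  rw [supp_eq hx]
  refine ⟨Set.sep_subset _ _, ?_⟩
  rintro f hf g hg _ ⟨-, h⟩ ⟨a, b, ha, hb, hab, rfl⟩
  refine ⟨hf, le_antisymm (apply_le_norm (by simpa using hf) x) ?_⟩
  have hg := apply_le_norm (by simpa using hg) x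
  simp only [add_apply, smul_apply, smul_eq_mul] at h
  obtain rfl : b = 1 - a := by linarith
  by_contra! hlt
  nlinarith [mul_lt_mul_of_pos_left hlt ha, mul_le_mul_of_nonneg_left hg hb.le]

/-- `J(x)` is a face of the dual ball, so being extreme in it is the same as being extreme in the
ball. -/
theorem extremePoints_supp {x : X} (hx : x ≠ 0) :
    (supp x).extremePoints ℝ = {φ ∈ extBall (StrongDual ℝ X) | φ x = ‖x‖} := by
  rw [(isExtreme_supp hx).extremePoints_eq, supp_eq hx]
  ext φ
  exact ⟨fun h => ⟨h.2, h.1.2⟩, fun h => ⟨⟨h.1.1, h.2⟩, h.1⟩⟩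

theorem isCompact_supp [FiniteDimensional ℝ X] {x : X} (hx : x ≠ 0) : IsCompact (supp x) := by
  rw [supp_eq hx]
  refine (isCompact_closedBall (0 : StrongDual ℝ X) 1).inter_right
    (isClosed_eq (by fun_prop) continuous_const : IsClosed {f : StrongDual ℝ X | f x = ‖x‖})

theorem convex_supp {x : X} (hx : x ≠ 0) : Convex ℝ (supp x) := by
  rw [supp_eq hx]
  refine (convex_closedBall (0 : StrongDual ℝ X) 1).inter ?_
  exact convex_hyperplane (f := fun f : StrongDual ℝ X => f x)
    ⟨fun _ _ => rfl, fun _ _ => rfl⟩ ‖x‖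

theorem supp_nonempty {x : X} (hx : x ≠ 0) : (supp x).Nonempty := by
  obtain ⟨g, h1, h2⟩ := exists_dual_vector ℝ x (norm_ne_zero_iff.2 hx)
  exact ⟨g, h1, by simpa using h2⟩

theorem exists_mem_extBall_apply_eq_norm [FiniteDimensional ℝ X] {x : X} (hx : x ≠ 0) :
    ∃ φ ∈ extBall (StrongDual ℝ X), φ x = ‖x‖ := by
  obtain ⟨φ, hφ⟩ := (isCompact_supp hx).extremePoints_nonempty (supp_nonempty hx)
  rw [extremePoints_supp hx] at hφ
  exact ⟨φ, hφ⟩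

/-! ### Smooth points and facets -/

/-- A point at which a single extreme functional attains the norm is smooth. -/
theorem mem_Sm_of_unique [FiniteDimensional ℝ X] {x : X} (hx : x ≠ 0) {φ : StrongDual ℝ X}
    (h : ∀ ψ ∈ extBall (StrongDual ℝ X), ψ x = ‖x‖ → ψ = φ) : x ∈ Sm φ := by
  refine ⟨hx, ?_⟩
  obtain ⟨χ, hχ, hχx⟩ := exists_mem_extBall_apply_eq_norm hx
  have hext : (supp x).extremePoints ℝ = {φ} := by
    rw [extremePoints_supp hx]
    ext ψ
    refine ⟨fun hψ => h ψ hψ.1 hψ.2, ?_⟩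
    rintro rfl
    exact h χ hχ hχx ▸ ⟨hχ, hχx⟩
  rw [← closure_convexHull_extremePoints (isCompact_supp hx) (convex_supp hx), hext]
  simp

theorem norm_eq_one_of_mem_Sm {φ : StrongDual ℝ X} {x : X} (hx : x ∈ Sm φ) : ‖φ‖ = 1 :=
  (hx.2 ▸ Set.mem_singleton φ : φ ∈ supp x).1

theorem apply_eq_norm_of_mem_Sm {φ : StrongDual ℝ X} {x : X} (hx : x ∈ Sm φ) : φ x = ‖x‖ :=
  (hx.2 ▸ Set.mem_singleton φ : φ ∈ supp x).2

theorem eq_of_mem_Sm {φ ψ : StrongDual ℝ X} {x : X} (hx : x ∈ Sm φ) (hψ : ‖ψ‖ ≤ 1)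
    (h : ψ x = ‖x‖) : ψ = φ := by
  have : ψ ∈ supp x := by
    rw [supp_eq hx.1]
    exact ⟨by simpa using hψ, h⟩
  rwa [hx.2] at this

theorem mem_extBall_of_mem_Sm {φ : StrongDual ℝ X} {x : X} (hx : x ∈ Sm φ) :
    φ ∈ extBall (StrongDual ℝ X) := by
  have : φ ∈ (supp x).extremePoints ℝ := by rw [hx.2]; simp
  rw [extremePoints_supp hx.1] at this
  exact this.1

/-- Every extreme functional of a polyhedral space is the only supporting functional of some
point. -/
theorem Sm_nonempty [FiniteDimensional ℝ X] [Nontrivial X] (hpoly : IsPolyhedral X)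
    {φ : StrongDual ℝ X} (hφ : φ ∈ extBall (StrongDual ℝ X)) : (Sm φ).Nonempty := by
  have hφ1 := norm_le_one_of_mem_extBall hφ
  -- The witness is the sum of all extreme points where `φ` equals one. Its norm is their number, so
  -- a functional norming it equals one at each of them.
  have hfin : {e ∈ extBall X | φ e = 1}.Finite := hpoly.subset (Set.sep_subset _ _)
  set A := hfin.toFinset with hA
  have hmem : ∀ e, e ∈ A ↔ e ∈ extBall X ∧ φ e = 1 := fun e => by simp [hA]
  have hsum : ∀ h : StrongDual ℝ X, h (∑ e ∈ A, e) = ∑ e ∈ A, h e := fun h => map_sum h _ _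
  have hφx : φ (∑ e ∈ A, e) = A.card := by
    rw [hsum, Finset.sum_congr rfl fun e he => ((hmem e).1 he).2]
    simp
  have hnorm : ‖∑ e ∈ A, e‖ = A.card := by
    refine le_antisymm ?_ (hφx ▸ apply_le_norm hφ1 _)
    refine (norm_sum_le _ _).trans ?_
    simpa using Finset.sum_le_sum fun e he => norm_le_one_of_mem_extBall ((hmem e).1 he).1
  have hne : ∑ e ∈ A, e ≠ 0 := by
    rw [← norm_ne_zero_iff, hnorm, Nat.cast_ne_zero, Finset.card_ne_zero]
    by_contra hemp
    rw [Finset.not_nonempty_iff_eq_empty] at hemp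
    obtain ⟨x, hx⟩ := exists_ne (0 : X)
    obtain ⟨h, hh⟩ := supp_nonempty hx
    have : h = 0 := eq_zero_of_vanish_on_active hpoly hφ fun e he h1 => by
      simpa [hemp] using (hmem e).2 ⟨he, h1⟩
    simpa [this] using hh.1
  refine ⟨∑ e ∈ A, e, mem_Sm_of_unique hne fun ψ hψ hψx => ?_⟩
  have hψ1 := norm_le_one_of_mem_extBall hψ
  have hle : ∀ e ∈ A, ψ e ≤ 1 := fun e he =>
    (apply_le_norm hψ1 e).trans (norm_le_one_of_mem_extBall ((hmem e).1 he).1)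
  have heq : ∑ e ∈ A, ψ e = ∑ e ∈ A, 1 := by rw [← hsum, hψx, hnorm]; simp
  rw [Finset.sum_eq_sum_iff_of_le hle] at heq
  refine sub_eq_zero.1 (eq_zero_of_vanish_on_active hpoly hφ fun e he h1 => ?_)
  simp [heq e ((hmem e).2 ⟨he, h1⟩), h1]

theorem norm_eq_one_of_mem_extBall_dual [FiniteDimensional ℝ X] [Nontrivial X]
    (hpoly : IsPolyhedral X) {φ : StrongDual ℝ X} (hφ : φ ∈ extBall (StrongDual ℝ X)) :
    ‖φ‖ = 1 :=
  norm_eq_one_of_mem_Sm (Sm_nonempty hpoly hφ).some_mem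

/-- `Sm φ` is a finite intersection of open half-spaces `ψ x < φ x`; the choice `ψ = -φ` excludes
the origin. -/
theorem isOpen_Sm [FiniteDimensional ℝ X] [Nontrivial X] (hpoly : IsPolyhedral X)
    {φ : StrongDual ℝ X} (hφ : φ ∈ extBall (StrongDual ℝ X)) : IsOpen (Sm φ) := by
  have : Sm φ = ⋂ ψ ∈ extBall (StrongDual ℝ X) \ {φ}, {x | ψ x < φ x} := by
    ext x
    simp only [Set.mem_iInter, Set.mem_ofPred_eq]
    constructor
    · intro hx ψ hψ
      rw [apply_eq_norm_of_mem_Sm hx]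
      refine (apply_le_norm (norm_le_one_of_mem_extBall hψ.1) x).lt_of_ne fun h => hψ.2 ?_
      exact eq_of_mem_Sm hx (norm_le_one_of_mem_extBall hψ.1) h
    · intro h
      have hne : -φ ≠ φ := by
        intro h
        have h0 := norm_eq_one_of_mem_extBall_dual hpoly hφ
        have h2 : (2 : ℝ) • φ = 0 := by
          rw [two_smul]
          nth_rewrite 1 [← h]
          simp
        simp_all
      refine mem_Sm_of_unique (fun hx => ?_) fun ψ hψ hψx => ?_
      · have := h (-φ) ⟨neg_mem_extBall hφ, hne⟩
        simp [hx] at this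
      · by_contra hψφ
        have := h ψ ⟨hψ, hψφ⟩
        have := apply_le_norm (norm_le_one_of_mem_extBall hφ) x
        linarith
  rw [this]
  refine (hpoly.dual.subset Set.sdiff_subset).isOpen_biInter fun ψ _ => ?_
  exact isOpen_lt ψ.continuous φ.continuous

/-- The smooth points of a polyhedral space are dense. -/
theorem dense_smooth [FiniteDimensional ℝ X] [Nontrivial X] (hpoly : IsPolyhedral X) :
    Dense {x : X | ∃ φ, x ∈ Sm φ} := by
  have hE := hpoly.dual
  have hker : ∀ f : StrongDual ℝ X, f ≠ 0 → Dense {x | f x ≠ 0} := by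
    intro f hf
    obtain ⟨v, hv⟩ : ∃ v, f v ≠ 0 := by
      by_contra! h
      exact hf (ContinuousLinearMap.ext h)
    intro x
    have hlim : Tendsto (fun t : ℝ => x + t • v) (𝓝[≠] 0) (𝓝 x) := by
      refine tendsto_nhdsWithin_of_tendsto_nhds ?_
      exact (by fun_prop : Continuous fun t : ℝ => x + t • v).tendsto' 0 x (by simp)
    refine mem_closure_of_frequently_of_tendsto ?_ hlim
    refine Eventually.frequently ?_
    have hcont : ∀ᶠ t : ℝ in 𝓝[≠] 0, t ≠ -(f x / f v) := by
      by_cases h0 : -(f x / f v) = 0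
      · rw [h0]; exact self_mem_nhdsWithin
      · exact nhdsWithin_le_nhds (isOpen_ne.mem_nhds (Ne.symm h0))
    filter_upwards [hcont] with t ht h
    refine ht ?_
    have h : f x + t * f v = 0 := by simpa using h
    field_simp
    linarith
  -- Off the finitely many hyperplanes where two extreme functionals agree, only one of them can
  -- attain the norm.
  have hD : Dense (⋂ p ∈ {p ∈ extBall (StrongDual ℝ X) ×ˢ extBall (StrongDual ℝ X) |
      p.1 - p.2 ≠ 0}, {x : X | (p.1 - p.2) x ≠ 0}) := by
    refine dense_biInter_of_isOpen (fun p _ => ?_)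
      ((hE.prod hE).subset (Set.sep_subset _ _)).countable fun p hp => hker _ hp.2
    exact isOpen_ne.preimage (p.1 - p.2).continuous
  have hD' := hD.inter_of_isOpen_right (t := {x : X | x ≠ 0}) (dense_compl_singleton (0 : X))
    isOpen_ne
  refine hD'.mono ?_
  rintro x ⟨hx, hx0⟩
  obtain ⟨φ, hφ, hφx⟩ := exists_mem_extBall_apply_eq_norm hx0
  refine ⟨φ, mem_Sm_of_unique hx0 fun ψ hψ hψx => ?_⟩
  by_contra hne
  rw [Set.mem_iInter₂] at hx
  exact hx (ψ, φ) ⟨⟨hψ, hφ⟩, sub_ne_zero.2 hne⟩ (by simp [hψx, hφx])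

/-- The cone over a facet is the closure of the set of its smooth points. -/
theorem mem_closure_Sm {φ : StrongDual ℝ X} {x y : X} (hx : x ∈ Sm φ) (hy : φ y = ‖y‖) :
    y ∈ closure (Sm φ) := by
  have hlim : Tendsto (fun t : ℝ => y + t • x) (𝓝[>] 0) (𝓝 y) := by
    refine tendsto_nhdsWithin_of_tendsto_nhds ?_
    exact (by fun_prop : Continuous fun t : ℝ => y + t • x).tendsto' 0 y (by simp)
  refine mem_closure_of_tendsto hlim ?_
  filter_upwards [self_mem_nhdsWithin] with t ht
  have ht : 0 < t := ht
  have hφ := norm_eq_one_of_mem_Sm hx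
  have hval : φ (y + t • x) = ‖y‖ + t * ‖x‖ := by simp [hy, apply_eq_norm_of_mem_Sm hx]
  have hpos : 0 < ‖x‖ := norm_pos_iff.2 hx.1
  have hn : ‖y + t • x‖ = ‖y‖ + t * ‖x‖ := by
    refine le_antisymm ((norm_add_le _ _).trans_eq ?_) (hval ▸ apply_le_norm hφ.le _)
    rw [norm_smul, Real.norm_of_nonneg ht.le]
  have hne : y + t • x ≠ 0 := by
    rw [← norm_pos_iff, hn]
    positivity
  refine ⟨hne, Set.eq_singleton_iff_unique_mem.2 ⟨⟨hφ, hval.trans hn.symm⟩, ?_⟩⟩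
  rintro h ⟨h1, h2⟩
  refine eq_of_mem_Sm hx h1.le (le_antisymm (apply_le_norm h1.le x) ?_)
  have h3 := apply_le_norm h1.le y
  rw [hn] at h2
  simp only [map_add, map_smul, smul_eq_mul] at h2
  exact le_of_mul_le_mul_left (by linarith) ht

/-! ### Approximate orthogonality and the constant `ε_X` -/

/-- Near `x` the norm coincides with `φ`, so `‖x + t • z‖ = ‖x‖ + t * φ z` for small `t > 0`;
compare the terms linear in `t`. -/
theorem neg_mul_norm_le_of_approxOrth [FiniteDimensional ℝ X] [Nontrivial X]
    (hpoly : IsPolyhedral X) {φ : StrongDual ℝ X} {x z : X} (hx : x ∈ Sm φ) {e : ℝ}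
    (h : ApproxOrth e x z) : -(e * ‖z‖) ≤ φ z := by
  by_contra! hlt
  have hpos : 0 < ‖x‖ := norm_pos_iff.2 hx.1
  have h1 : ∀ᶠ t : ℝ in 𝓝 0, x + t • z ∈ Sm φ := by
    refine (Continuous.tendsto' (by fun_prop) (0 : ℝ) x (by simp)).eventually ?_
    exact (isOpen_Sm hpoly (mem_extBall_of_mem_Sm hx)).mem_nhds hx
  have h2 : ∀ᶠ t : ℝ in 𝓝 0, 2 * ‖x‖ * (φ z + e * ‖z‖) + t * φ z ^ 2 < 0 := by
    refine (Continuous.tendsto (by fun_prop) (0 : ℝ)).eventually_lt_const ?_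
    have := mul_pos hpos (by linarith : 0 < -(φ z + e * ‖z‖))
    linarith
  obtain ⟨t, ⟨ht1, ht2⟩, ht⟩ := (((h1.and h2).filter_mono nhdsWithin_le_nhds).and
    (self_mem_nhdsWithin : Set.Ioi (0 : ℝ) ∈ 𝓝[>] 0)).exists
  have ht : 0 < t := ht
  have h3 := h t
  rw [← apply_eq_norm_of_mem_Sm ht1, map_add, map_smul, apply_eq_norm_of_mem_Sm hx, norm_smul,
    Real.norm_of_nonneg ht.le, smul_eq_mul] at h3
  have := mul_pos ht (neg_pos.2 ht2)
  nlinarith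

/-- At a smooth point, approximate orthogonality bounds the supporting functional. -/
theorem abs_apply_le_of_approxOrth [FiniteDimensional ℝ X] [Nontrivial X]
    (hpoly : IsPolyhedral X) {φ : StrongDual ℝ X} {x z : X} (hx : x ∈ Sm φ) {e : ℝ}
    (h : ApproxOrth e x z) : |φ z| ≤ e * ‖z‖ := by
  refine abs_le.2 ⟨neg_mul_norm_le_of_approxOrth hpoly hx h, ?_⟩
  have h' : ApproxOrth e x (-z) := fun l => by simpa using h (-l)
  have := neg_mul_norm_le_of_approxOrth hpoly hx h'
  rw [norm_neg, map_neg] at this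
  linarith

theorem ApproxOrth.mono {e e' : ℝ} (hee : e ≤ e') {x y : X} (h : ApproxOrth e x y) :
    ApproxOrth e' x y := fun l => by
  refine le_trans ?_ (h l)
  have : e * (‖x‖ * ‖l • y‖) ≤ e' * (‖x‖ * ‖l • y‖) := by gcongr
  linarith

theorem bjOrth_of_apply_eq_zero {x y : X} {φ : StrongDual ℝ X} (hφ : ‖φ‖ ≤ 1)
    (hx : φ x = ‖x‖) (hy : φ y = 0) : BJOrth x y := fun l => by
  have := apply_le_norm hφ (x + l • y)
  simpa [hx, hy] using this

/-- A functional which is small on a subspace is near the annihilator of that subspace. -/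
theorem exists_norm_le_eqOn (H : Submodule ℝ X) (φ : StrongDual ℝ X) {e : ℝ} (he : 0 ≤ e)
    (h : ∀ z ∈ H, |φ z| ≤ e * ‖z‖) :
    ∃ r : StrongDual ℝ X, ‖r‖ ≤ e ∧ ∀ z ∈ H, r z = φ z := by
  obtain ⟨r, hr, hn⟩ := exists_extension_norm_eq H (φ.comp H.subtypeL)
  refine ⟨r, hn.trans_le ?_, fun z hz => hr ⟨z, hz⟩⟩
  exact ContinuousLinearMap.opNorm_le_bound _ he fun z => by simpa using h z z.2

theorem exists_lower_bound_of_linearIndependent {E : Type*} [NormedAddCommGroup E]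
    [NormedSpace ℝ E] {φ ψ : E} (h : LinearIndependent ℝ ![φ, ψ]) :
    ∃ m : ℝ, 0 < m ∧ ∀ a b : ℝ, m * (|a| + |b|) ≤ ‖a • φ + b • ψ‖ := by
  let L : ℝ × ℝ →ₗ[ℝ] E :=
    (LinearMap.toSpanSingleton ℝ E φ).coprod (LinearMap.toSpanSingleton ℝ E ψ)
  have hL : LinearMap.ker L = ⊥ := by
    rw [LinearMap.ker_eq_bot']
    rintro ⟨a, b⟩ hab
    have := LinearIndependent.pair_iff.1 h a b (by simpa [L] using hab)
    simp [this]
  obtain ⟨K, hK, hanti⟩ := L.exists_antilipschitzWith hL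
  have hK : (0 : ℝ) < K := hK
  refine ⟨(2 * K)⁻¹, by positivity, fun a b => ?_⟩
  have h1 := hanti.le_mul_dist (a, b) 0
  rw [map_zero, dist_zero_right, dist_zero_right] at h1
  have h2 : L (a, b) = a • φ + b • ψ := by simp [L]
  have ha : |a| ≤ ‖(a, b)‖ := norm_fst_le (a, b)
  have hb : |b| ≤ ‖(a, b)‖ := norm_snd_le (a, b)
  rw [h2] at h1
  rw [inv_mul_le_iff₀ (by positivity)]
  linarith

/-- If `φ` and `ψ` were both at most `e` on a hyperplane, Hahn–Banach would put both within `e` of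
its one-dimensional annihilator, which independence forbids for small `e`. -/
theorem exists_isSeparating [FiniteDimensional ℝ X] [Nontrivial X] (hpoly : IsPolyhedral X)
    {φ ψ : StrongDual ℝ X} (hφ : φ ∈ extBall (StrongDual ℝ X))
    (hi : LinearIndependent ℝ ![φ, ψ]) : ∃ e, IsSeparating e φ ψ := by
  obtain ⟨m, hm, hbound⟩ := exists_lower_bound_of_linearIndependent hi
  -- Being below `m` forces `a = b = 0` later on; being below one then contradicts `‖φ‖ = 1`.
  refine ⟨min m 1 / 2, by positivity, by linarith [min_le_right m 1], ?_⟩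
  have hem : min m 1 / 2 < m := by linarith [min_le_left m 1]
  have he1 : min m 1 / 2 < 1 := by linarith [min_le_right m 1]
  have he0 : 0 ≤ min m 1 / 2 := by positivity
  generalize min m 1 / 2 = e at hem he1 he0
  intro x hx y hy H hH hsub
  obtain ⟨r, hr, hrH⟩ := exists_norm_le_eqOn H φ he0 fun z hz =>
    abs_apply_le_of_approxOrth hpoly hx (hsub hz).1
  obtain ⟨s, hs, hsH⟩ := exists_norm_le_eqOn H ψ he0 fun z hz =>
    abs_apply_le_of_approxOrth hpoly hy (hsub hz).2
  obtain ⟨v, hv⟩ : ∃ v, v ∉ H := by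
    by_contra! h
    exact hH.1 (eq_top_iff.2 fun v _ => h v)
  have hext : ∀ f : StrongDual ℝ X, (∀ z ∈ H, f z = 0) → f v = 0 → f = 0 := by
    intro f hfH hfv
    have hlt : H < LinearMap.ker f.toLinearMap :=
      lt_of_le_of_ne (fun z hz => by simpa using hfH z hz) fun h => hv (h ▸ by simpa using hfv)
    ext z
    have : z ∈ LinearMap.ker f.toLinearMap := hH.2 _ hlt ▸ Submodule.mem_top
    simpa using this
  set a := (φ - r) v with ha
  set b := (ψ - s) v with hb
  have h0 : b • (φ - r) - a • (ψ - s) = 0 := by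
    refine hext _ (fun z hz => by simp [hrH z hz, hsH z hz]) ?_
    rw [sub_apply, smul_apply, smul_apply, ← ha, ← hb, smul_eq_mul, smul_eq_mul]
    ring
  have h1 : b • φ + (-a) • ψ = b • r + (-a) • s := by
    rw [← sub_eq_zero, ← h0]
    module
  have h2 := hbound b (-a)
  have h3 : ‖b • r + (-a) • s‖ ≤ e * (|b| + |(-a)|) := by
    refine (norm_add_le _ _).trans ?_
    rw [norm_smul, norm_smul, Real.norm_eq_abs, Real.norm_eq_abs, mul_add, mul_comm e, mul_comm e]
    gcongr
  rw [h1] at h2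
  have h4 : |b| + |(-a)| = 0 := by
    by_contra hne
    have hp : 0 < |b| + |(-a)| := lt_of_le_of_ne (by positivity) (Ne.symm hne)
    nlinarith [mul_lt_mul_of_pos_right hem hp]
  have h5 : a = 0 := by
    rw [← neg_eq_zero, ← abs_eq_zero]
    linarith [abs_nonneg b, abs_nonneg (-a)]
  have h6 : φ - r = 0 := hext _ (fun z hz => by simp [hrH z hz]) h5
  have h7 := norm_eq_one_of_mem_extBall_dual hpoly hφ
  rw [sub_eq_zero.1 h6] at h7
  linarith

theorem exists_linearIndependent_extBall [FiniteDimensional ℝ X] [Nontrivial X]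
    (hdim : 1 < Module.finrank ℝ X) (hpoly : IsPolyhedral X) :
    ∃ φ ∈ extBall (StrongDual ℝ X), ∃ ψ ∈ extBall (StrongDual ℝ X),
      LinearIndependent ℝ ![φ, ψ] := by
  obtain ⟨x, hx⟩ := exists_ne (0 : X)
  obtain ⟨φ, hφ, -⟩ := exists_mem_extBall_apply_eq_norm hx
  have hφ0 : φ ≠ 0 := norm_ne_zero_iff.1 (by simp [norm_eq_one_of_mem_extBall_dual hpoly hφ])
  obtain ⟨y, hy, hy0⟩ := Submodule.exists_mem_ne_zero_of_ne_bot
    (LinearMap.ker_ne_bot_of_finrank_lt (f := φ.toLinearMap) (by simpa using hdim))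
  obtain ⟨ψ, hψ, hψy⟩ := exists_mem_extBall_apply_eq_norm hy0
  refine ⟨φ, hφ, ψ, hψ, (LinearIndependent.pair_iff' hφ0).2 ?_⟩
  rintro a rfl
  have hy : φ y = 0 := by simpa using hy
  refine hy0 (norm_eq_zero.1 ?_)
  rw [← hψy, smul_apply, hy, smul_zero]

theorem exists_isOrthConst [FiniteDimensional ℝ X] (hdim : 1 < Module.finrank ℝ X)
    (hpoly : IsPolyhedral X) : ∃ c, IsOrthConst X c := by
  have : Nontrivial X := Module.nontrivial_of_finrank_pos (R := ℝ) (by lia)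
  have hsep : ∀ φ ψ : StrongDual ℝ X, ∃ e, φ ∈ extBall (StrongDual ℝ X) →
      LinearIndependent ℝ ![φ, ψ] → IsSeparating e φ ψ := by
    intro φ ψ
    by_cases h : φ ∈ extBall (StrongDual ℝ X) ∧ LinearIndependent ℝ ![φ, ψ]
    · obtain ⟨e, he⟩ := exists_isSeparating hpoly h.1 h.2
      exact ⟨e, fun _ _ => he⟩
    -- A dummy value, never used for the minimum.
    · exact ⟨0, fun h1 h2 => absurd ⟨h1, h2⟩ h⟩
  choose e he using hsep
  set S := {r : ℝ | ∃ φ ∈ extBall (StrongDual ℝ X), ∃ ψ ∈ extBall (StrongDual ℝ X),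
      LinearIndependent ℝ ![φ, ψ] ∧ r = e φ ψ} with hS
  have hfin : S.Finite := by
    refine (hpoly.dual.image2 e hpoly.dual).subset ?_
    rintro _ ⟨φ, hφ, ψ, hψ, -, rfl⟩
    exact ⟨φ, hφ, ψ, hψ, rfl⟩
  have hne : S.Nonempty := by
    obtain ⟨φ, hφ, ψ, hψ, h⟩ := exists_linearIndependent_extBall hdim hpoly
    exact ⟨_, φ, hφ, ψ, hψ, h, rfl⟩
  obtain ⟨c, hc, hmin⟩ := hfin.exists_minimal hne
  refine ⟨c, e, fun φ hφ ψ _ h => he φ ψ hφ h, hc, fun r hr => ?_⟩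
  rcases le_total c r with h | h
  · exact h
  · exact hmin hr h

/-! ### From facets to isometries -/

/-- A bijective operator of norm one that takes equal values in norm at the extreme points of the
ball and maps facets into facets (up to sign) is an isometry, provided that extreme points have
more extreme supporting functionals than other unit vectors. -/
theorem isometry_of_maps_facets [FiniteDimensional ℝ X] [Nontrivial X] (hpoly : IsPolyhedral X)
    (hext : ∀ u ∈ extBall X, ∀ v : X, ‖v‖ = 1 → v ∉ extBall X →
      ((supp v).extremePoints ℝ).encard < ((supp u).extremePoints ℝ).encard)
    (T : X ≃L[ℝ] X) (hT : ‖(T : X →L[ℝ] X)‖ = 1)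
    (hnorm : ∀ u ∈ extBall X, ∀ v ∈ extBall X, ‖T u‖ = ‖T v‖)
    (hfacet : ∀ φ ∈ extBall (StrongDual ℝ X), ∃ g ∈ extBall (StrongDual ℝ X),
      ∀ x, φ x = ‖x‖ → |g (T x)| = ‖T x‖) : Isometry T := by
  have hsign : ∀ φ ∈ extBall (StrongDual ℝ X), ∃ g ∈ extBall (StrongDual ℝ X),
      ∀ x, φ x = ‖x‖ → g (T x) = ‖T x‖ := by
    intro φ hφ
    obtain ⟨x, hx⟩ := Sm_nonempty hpoly hφ
    have hφx := apply_eq_norm_of_mem_Sm hx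
    obtain ⟨g, hg, hgT, hgx⟩ : ∃ g ∈ extBall (StrongDual ℝ X),
        (∀ x, φ x = ‖x‖ → |g (T x)| = ‖T x‖) ∧ g (T x) = ‖T x‖ := by
      obtain ⟨g, hg, h⟩ := hfacet φ hφ
      rcases abs_choice (g (T x)) with h1 | h1
      · exact ⟨g, hg, h, by rw [← h1, h x hφx]⟩
      · exact ⟨-g, neg_mem_extBall hg, by simpa using h, by
          rw [neg_apply, ← h1, h x hφx]⟩
    refine ⟨g, hg, fun y hy => ?_⟩
    rcases abs_choice (g (T y)) with h1 | h1
    · rw [← h1, hgT y hy]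
    have hgy : g (T y) = -‖T y‖ := by linarith [hgT y hy]
    rcases eq_or_ne y 0 with rfl | hy0
    · simp
    have hTx : 0 < ‖T x‖ := norm_pos_iff.2 (by simpa using hx.1)
    have hTy : 0 < ‖T y‖ := norm_pos_iff.2 (by simpa using hy0)
    have hx0 : 0 < ‖x‖ := norm_pos_iff.2 hx.1
    -- If the signs at `x` and `y` differed, these weights would give `g (T w) = 0` with `w` still
    -- in the cone, hence `T w = 0`, although `φ w > 0`.
    set w := ‖T y‖ • x + ‖T x‖ • y with hw
    have hφw : φ w = ‖T y‖ * ‖x‖ + ‖T x‖ * ‖y‖ := by simp [hw, hφx, hy]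
    have hφw' : φ w = ‖w‖ := by
      refine le_antisymm (apply_le_norm (norm_le_one_of_mem_extBall hφ) w) ?_
      rw [hφw]
      refine (norm_add_le _ _).trans_eq ?_
      simp [norm_smul]
    have hgw : g (T w) = 0 := by
      simp only [hw, map_add, map_smul, hgx, hgy, smul_eq_mul]
      ring
    have hw0 := hgT w hφw'
    rw [hgw, abs_zero, eq_comm, norm_eq_zero, T.map_eq_zero_iff] at hw0
    rw [hw0, map_zero] at hφw
    have : 0 < ‖T y‖ * ‖x‖ + ‖T x‖ * ‖y‖ := by positivity
    linarith
  choose! γ hγ hγT using hsign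
  have hsurj : Set.SurjOn γ (extBall (StrongDual ℝ X)) (extBall (StrongDual ℝ X)) := by
    intro g hg
    obtain ⟨y, hy⟩ := Sm_nonempty hpoly hg
    have hx0 : T.symm y ≠ 0 := by simpa using hy.1
    obtain ⟨φ, hφ, hφx⟩ := exists_mem_extBall_apply_eq_norm hx0
    refine ⟨φ, hφ, eq_of_mem_Sm hy (norm_le_one_of_mem_extBall (hγ φ hφ)) ?_⟩
    simpa using hγT φ hφ _ hφx
  have hinj : Set.InjOn γ (extBall (StrongDual ℝ X)) := by
    have : Finite (extBall (StrongDual ℝ X)) := hpoly.dual.to_subtype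
    have hmaps : Set.MapsTo γ (extBall (StrongDual ℝ X)) (extBall (StrongDual ℝ X)) := hγ
    rw [← hmaps.restrict_inj, Finite.injective_iff_surjective]
    exact (hmaps.restrict_surjective_iff).2 hsurj
  have hcount : ∀ u : X, u ≠ 0 →
      ((supp u).extremePoints ℝ).encard ≤ ((supp (T u)).extremePoints ℝ).encard := by
    intro u hu
    rw [extremePoints_supp hu, extremePoints_supp (by simpa using hu)]
    refine Set.encard_le_encard_of_injOn (f := γ) ?_ (hinj.mono (Set.sep_subset _ _))
    exact fun φ hφ => ⟨hγ φ hφ.1, hγT φ hφ.1 u hφ.2⟩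
  have hnorm1 : ∀ u ∈ extBall X, ‖T u‖ = 1 := by
    intro u hu
    refine le_antisymm ?_ ?_
    · exact (T : X →L[ℝ] X).le_of_opNorm_le_of_le hT.le (norm_le_one_of_mem_extBall hu)
        |>.trans_eq (one_mul 1)
    · rw [← hT]
      exact opNorm_le_of_extBall _ (norm_nonneg _) fun v hv => (hnorm v hv u hu).le
  have hmaps : Set.MapsTo T (extBall X) (extBall X) := by
    intro u hu
    by_contra hTu
    have hu0 : u ≠ 0 := by
      rintro rfl
      simpa using hnorm1 0 hu
    exact (hcount u hu0).not_gt (hext u hu _ (hnorm1 u hu) hTu)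
  have hTsurj : Set.SurjOn T (extBall X) (extBall X) := by
    have : Finite (extBall X) := hpoly.to_subtype
    rw [← hmaps.restrict_surjective_iff, ← Finite.injective_iff_surjective, hmaps.restrict_inj]
    exact T.injective.injOn
  have hsymm : ‖(T.symm : X →L[ℝ] X)‖ ≤ 1 := by
    refine opNorm_le_of_extBall _ zero_le_one fun v hv => ?_
    obtain ⟨u, hu, rfl⟩ := hTsurj hv
    simpa using norm_le_one_of_mem_extBall hu
  refine AddMonoidHomClass.isometry_of_norm T fun x => le_antisymm ?_ ?_
  · simpa using (T : X →L[ℝ] X).le_of_opNorm_le hT.le x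
  · simpa using (T.symm : X →L[ℝ] X).le_of_opNorm_le hsymm (T x)

/-! ### Both preservation properties map facets into facets -/

theorem dense_preimage_smooth [FiniteDimensional ℝ X] [Nontrivial X] (hpoly : IsPolyhedral X)
    (T : X ≃L[ℝ] X) : Dense {x : X | ∃ g, T x ∈ Sm g} :=
  (dense_smooth hpoly).preimage T.toHomeomorph.isOpenMap

theorem exists_mem_Sm_map_mem_Sm [FiniteDimensional ℝ X] [Nontrivial X] (hpoly : IsPolyhedral X)
    (T : X ≃L[ℝ] X) {φ : StrongDual ℝ X} (hφ : φ ∈ extBall (StrongDual ℝ X)) :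
    ∃ x ∈ Sm φ, ∃ g, T x ∈ Sm g :=
  (dense_preimage_smooth hpoly T).exists_mem_open (isOpen_Sm hpoly hφ) (Sm_nonempty hpoly hφ)
    |>.imp fun _ h => ⟨h.2, h.1⟩

/-- A functional norming `T x ± T y` norms `T x`; when `T x` is smooth it must be `g`. -/
theorem maps_facets_of_preservesParallelPairs [FiniteDimensional ℝ X] [Nontrivial X]
    (hpoly : IsPolyhedral X) (T : X ≃L[ℝ] X) (hpar : PreservesParallelPairs (T : X →L[ℝ] X))
    {φ : StrongDual ℝ X} (hφ : φ ∈ extBall (StrongDual ℝ X)) :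
    ∃ g ∈ extBall (StrongDual ℝ X), ∀ x, φ x = ‖x‖ → |g (T x)| = ‖T x‖ := by
  obtain ⟨x, hx, g, hg⟩ := exists_mem_Sm_map_mem_Sm hpoly T hφ
  refine ⟨g, mem_extBall_of_mem_Sm hg, fun y hy => ?_⟩
  obtain ⟨l, hl, h⟩ := hpar x y ⟨1, abs_one, by
    rw [one_smul]
    refine le_antisymm (norm_add_le _ _) ?_
    have := apply_le_norm (norm_le_one_of_mem_extBall hφ) (x + y)
    rwa [map_add, hy, apply_eq_norm_of_mem_Sm hx] at this⟩
  simp only [ContinuousLinearEquiv.coe_coe] at h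
  have hne : T x + l • T y ≠ 0 := by
    rw [← norm_pos_iff, h]
    have := norm_pos_iff.2 hg.1
    positivity
  obtain ⟨f, hf1, hf2⟩ := supp_nonempty hne
  rw [h, map_add] at hf2
  have h1 := apply_le_norm hf1.le (T x)
  have h2 := apply_le_norm hf1.le (l • T y)
  have hln : ‖l • T y‖ = ‖T y‖ := by rw [norm_smul, Real.norm_eq_abs, hl, one_mul]
  obtain rfl := eq_of_mem_Sm hg hf1.le (by linarith)
  have h3 : l * f (T y) = ‖T y‖ := by
    rw [← smul_eq_mul, ← map_smul]
    linarith
  rw [← h3, ← one_mul |f (T y)|, ← hl, ← abs_mul, h3, abs_norm]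

theorem eq_or_eq_neg_of_not_linearIndependent {E : Type*} [NormedAddCommGroup E]
    [NormedSpace ℝ E] {f g : E} (hf : ‖f‖ = 1) (hg : ‖g‖ = 1)
    (h : ¬ LinearIndependent ℝ ![f, g]) : g = f ∨ g = -f := by
  rw [LinearIndependent.pair_iff' (norm_ne_zero_iff.1 (by simp [hf]))] at h
  push Not at h
  obtain ⟨a, rfl⟩ := h
  rw [norm_smul, hf, mul_one, Real.norm_eq_abs] at hg
  rcases eq_or_eq_neg_of_abs_eq hg with rfl | rfl <;> simp

theorem maps_facets_of_preservesApproxOrth [FiniteDimensional ℝ X] [Nontrivial X]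
    (hpoly : IsPolyhedral X) {c ε : ℝ} (hc : IsOrthConst X c) (hε : ε < c) (T : X ≃L[ℝ] X)
    (horth : ∀ x, PreservesApproxOrthAt ε (T : X →L[ℝ] X) x)
    {φ : StrongDual ℝ X} (hφ : φ ∈ extBall (StrongDual ℝ X)) :
    ∃ g ∈ extBall (StrongDual ℝ X), ∀ x, φ x = ‖x‖ → |g (T x)| = ‖T x‖ := by
  obtain ⟨e, he, -, hmin⟩ := hc
  obtain ⟨x, hx, g, hg⟩ := exists_mem_Sm_map_mem_Sm hpoly T hφ
  have hφ1 := norm_eq_one_of_mem_extBall_dual hpoly hφ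
  refine ⟨g, mem_extBall_of_mem_Sm hg, fun z hz => ?_⟩
  -- The kernel of `χ` is the image under `T` of `ker φ`.
  let χ : X →ₗ[ℝ] ℝ := φ.toLinearMap ∘ₗ T.symm.toLinearEquiv.toLinearMap
  have hH : IsCoatom (LinearMap.ker χ) := by
    refine LinearMap.isCoatom_ker_of_surjective (LinearMap.surjective fun h => ?_)
    have h1 : χ (T x) = 0 := by rw [h]; rfl
    have h2 : φ x = 0 := by simpa [χ] using h1
    rw [apply_eq_norm_of_mem_Sm hx] at h2
    exact hx.1 (norm_eq_zero.1 h2)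
  have happrox : ∀ y ∈ Sm φ, ∀ e', ε ≤ e' → ∀ w ∈ LinearMap.ker χ, ApproxOrth e' (T y) w := by
    intro y hy e' he' w hw
    have h0 : φ (T.symm w) = 0 := by simpa [χ] using hw
    have := horth y _ (bjOrth_of_apply_eq_zero hφ1.le (apply_eq_norm_of_mem_Sm hy) h0)
    exact ApproxOrth.mono he' (by simpa using this)
  have hclosed : IsClosed {z : X | |g (T z)| = ‖T z‖} := by
    refine isClosed_eq ?_ ?_ <;> fun_prop
  -- It suffices to treat points of `Sm φ` with smooth image, which are dense in the cone.
  refine closure_minimal (s := Sm φ ∩ {x : X | ∃ g, T x ∈ Sm g}) ?_ hclosed ?_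
  · rintro y ⟨hy, g', hg'⟩
    have hdep : ¬ LinearIndependent ℝ ![g, g'] := by
      intro hi
      have hgE := mem_extBall_of_mem_Sm hg
      have hgE' := mem_extBall_of_mem_Sm hg'
      have hle : ε ≤ e g g' := hε.le.trans (hmin ⟨g, hgE, g', hgE', hi, rfl⟩)
      exact (he g hgE g' hgE' hi).2.2 _ hg _ hg' _ hH fun w hw =>
        ⟨happrox x hx _ hle w hw, happrox y hy _ hle w hw⟩
    have hy' := apply_eq_norm_of_mem_Sm hg'
    rcases eq_or_eq_neg_of_not_linearIndependent (norm_eq_one_of_mem_Sm hg)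
      (norm_eq_one_of_mem_Sm hg') hdep with rfl | rfl
    · simp [hy']
    · rw [neg_apply] at hy'
      simp only [Set.mem_ofPred_eq]
      rw [← abs_neg, hy', abs_norm]
  · exact closure_minimal ((dense_preimage_smooth hpoly T).open_subset_closure_inter
      (isOpen_Sm hpoly hφ)) isClosed_closure (mem_closure_Sm hx hz)

/-! ### Injectivity from approximate orthogonality -/

theorem not_approxOrth_self {ε : ℝ} (hε : ε < 1) {x : X} (hx : x ≠ 0) :
    ¬ ApproxOrth ε x x := by
  intro h
  -- At `l = -t`, self-orthogonality would require `t ≥ 2 * (1 - ε)`; the cap keeps `1 - t`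
  -- nonnegative.
  set t := min (1 - ε) 1 with ht
  have ht0 : 0 < t := lt_min (by linarith) one_pos
  have ht1 : t ≤ 1 := min_le_right _ _
  have ht2 : t ≤ 1 - ε := min_le_left _ _
  have hpos : 0 < ‖x‖ := norm_pos_iff.2 hx
  have h1 := h (-t)
  have h2 : x + (-t) • x = (1 - t) • x := by module
  rw [h2, norm_smul, norm_smul, Real.norm_of_nonneg (by linarith : 0 ≤ 1 - t), norm_neg,
    Real.norm_of_nonneg ht0.le] at h1
  have h3 : 0 ≤ ‖x‖ ^ 2 * (t * (t - 2 * (1 - ε))) := by linarith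
  have h4 : t * (t - 2 * (1 - ε)) < 0 := mul_neg_of_pos_of_neg ht0 (by linarith)
  have h5 := mul_neg_of_pos_of_neg (pow_pos hpos 2) h4
  linarith

/-- A nonzero operator preserving approximate orthogonality is injective. -/
theorem injective_of_preservesApproxOrth {ε : ℝ} (hε : ε < 1) {T : X →L[ℝ] X} (hT : T ≠ 0)
    (horth : ∀ x, PreservesApproxOrthAt ε T x) : Function.Injective T := by
  rw [injective_iff_map_eq_zero]
  intro x hx
  by_contra hx0
  obtain ⟨y, hy⟩ : ∃ y, T y ≠ 0 := by
    by_contra! h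
    exact hT (ContinuousLinearMap.ext h)
  -- If `f x ≠ 0`, subtracting a multiple of `x` from `u` gives a vector orthogonal to `u` side but
  -- with image `T y`, making `T y` orthogonal to itself.
  have key : ∀ u, T u = T y → ∀ f ∈ supp u, f x = 0 := by
    intro u hu f hf
    by_contra hfx
    have h := horth u (u - (f u / f x) • x)
      (bjOrth_of_apply_eq_zero hf.1.le hf.2 (by simp [hfx]))
    rw [map_sub, map_smul, hx, smul_zero, sub_zero, hu] at h
    exact not_approxOrth_self hε hy h
  have hpos : 0 < ‖x‖ := norm_pos_iff.2 hx0
  -- Chosen so that `‖y + l • x‖ > ‖y‖`, while `key` gives `‖y + l • x‖ = f y ≤ ‖y‖`.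
  set l := (2 * ‖y‖ + 1) / ‖x‖ with hl
  have hTu : T (y + l • x) = T y := by simp [hx]
  have hu0 : y + l • x ≠ 0 := fun h => hy (by rw [← hTu, h, map_zero])
  obtain ⟨f, hf⟩ := supp_nonempty hu0
  have h1 := hf.2
  rw [map_add, map_smul, key _ hTu f hf, smul_zero, add_zero] at h1
  have h2 := apply_le_norm hf.1.le y
  have h3 : ‖l • x‖ = 2 * ‖y‖ + 1 := by
    rw [norm_smul, Real.norm_of_nonneg (by positivity), hl]
    field_simp
  have h4 := norm_sub_le (y + l • x) y
  rw [add_sub_cancel_left] at h4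
  linarith

theorem IsOrthConst.pos {c : ℝ} (hc : IsOrthConst X c) : 0 < c := by
  obtain ⟨e, he, ⟨φ, hφ, ψ, hψ, hi, rfl⟩, -⟩ := hc
  exact (he φ hφ ψ hψ hi).1

theorem IsOrthConst.lt_one {c : ℝ} (hc : IsOrthConst X c) : c < 1 := by
  obtain ⟨e, he, ⟨φ, hφ, ψ, hψ, hi, rfl⟩, -⟩ := hc
  exact (he φ hφ ψ hψ hi).2.1

theorem exists_equiv_of_injective [FiniteDimensional ℝ X] {T : X →L[ℝ] X}
    (hT : Function.Injective T) : ∃ S : X ≃L[ℝ] X, (S : X →L[ℝ] X) = T := by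
  refine ⟨(LinearEquiv.ofInjectiveEndo T.toLinearMap hT).toContinuousLinearEquiv, ?_⟩
  ext x
  rfl

theorem norm_eq_one_of_mem_extBall [Nontrivial X] {u : X} (hu : u ∈ extBall X) : ‖u‖ = 1 := by
  refine le_antisymm (norm_le_one_of_mem_extBall hu) ?_
  by_contra! hlt
  obtain ⟨x, hx⟩ := exists_ne (0 : X)
  have hpos : 0 < ‖x‖ := norm_pos_iff.2 hx
  set t := (1 - ‖u‖) / ‖x‖ with ht
  have ht0 : 0 < t := div_pos (by linarith) hpos
  have htx : ‖t • x‖ = 1 - ‖u‖ := by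
    rw [norm_smul, Real.norm_of_nonneg ht0.le, ht]
    field_simp
  rw [extBall, mem_extremePoints_iff_left] at hu
  have := hu.2 (u + t • x) (by simpa using (norm_add_le _ _).trans (by linarith))
    (u - t • x) (by simpa using (norm_sub_le _ _).trans (by linarith))
    ⟨1 / 2, 1 / 2, by norm_num, by norm_num, by norm_num, by module⟩
  simp [ht0.ne', hx] at this

end ParallelPairs


theorem mainTheorem12 {X : Type*} [NormedAddCommGroup X] [NormedSpace ℝ X]
    [FiniteDimensional ℝ X] (hdim : 1 < Module.finrank ℝ X)
    (hpoly : ParallelPairs.IsPolyhedral X)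
    (hext : ∀ u ∈ ParallelPairs.extBall X, ∀ v : X, ‖v‖ = 1 → v ∉ ParallelPairs.extBall X →
      ((ParallelPairs.supp v).extremePoints ℝ).encard <
        ((ParallelPairs.supp u).extremePoints ℝ).encard)
    (T : X →L[ℝ] X) (hT : ‖T‖ = 1) :
    (∃ c : ℝ, ParallelPairs.IsOrthConst X c) ∧
    ∀ c : ℝ, ParallelPairs.IsOrthConst X c →
      List.TFAE
        [ Isometry T,
          Function.Bijective T ∧ ParallelPairs.PreservesParallelPairs T ∧
            ∀ u ∈ ParallelPairs.extBall X, ∀ v ∈ ParallelPairs.extBall X, ‖T u‖ = ‖T v‖,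
          (∀ ε : ℝ, 0 ≤ ε → ε < c → ∀ x : X, ParallelPairs.PreservesApproxOrthAt ε T x) ∧
            ∀ u ∈ ParallelPairs.extBall X, ∀ v ∈ ParallelPairs.extBall X, ‖T u‖ = ‖T v‖,
          (∃ ε : ℝ, 0 ≤ ε ∧ ε < c ∧ ∀ x : X, ParallelPairs.PreservesApproxOrthAt ε T x) ∧
            ∀ u ∈ ParallelPairs.extBall X, ∀ v ∈ ParallelPairs.extBall X, ‖T u‖ = ‖T v‖ ] := by
  have : Nontrivial X := Module.nontrivial_of_finrank_pos (R := ℝ) (by lia)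
  refine ⟨ParallelPairs.exists_isOrthConst hdim hpoly, fun c hc => ?_⟩
  have hTn : Isometry T → ∀ x, ‖T x‖ = ‖x‖ := fun h x => h.norm_map_of_map_zero (map_zero T) x
  have hTe : Isometry T →
      ∀ u ∈ ParallelPairs.extBall X, ∀ v ∈ ParallelPairs.extBall X, ‖T u‖ = ‖T v‖ := by
    intro h u hu v hv
    rw [hTn h, hTn h, ParallelPairs.norm_eq_one_of_mem_extBall hu,
      ParallelPairs.norm_eq_one_of_mem_extBall hv]
  tfae_have 1 → 2 := by
    intro h
    refine ⟨⟨h.injective, (LinearMap.injective_iff_surjective (f := T.toLinearMap)).1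
      h.injective⟩, ?_, hTe h⟩
    rintro x y ⟨l, hl, hxy⟩
    refine ⟨l, hl, ?_⟩
    rw [← map_smul, ← map_add, hTn h, hTn h, hTn h, hxy]
  tfae_have 1 → 3 := by
    intro h
    refine ⟨fun ε hε0 _ x y hxy l => ?_, hTe h⟩
    rw [← map_smul, ← map_add, hTn h, hTn h, hTn h]
    have h1 : ‖x‖ ^ 2 ≤ ‖x + l • y‖ ^ 2 := pow_le_pow_left₀ (norm_nonneg x) (hxy l) 2
    have h2 : 0 ≤ 2 * ε * ‖x‖ * ‖l • y‖ := by positivity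
    linarith
  tfae_have 3 → 4 := fun h => ⟨⟨0, le_rfl, hc.pos, h.1 0 le_rfl hc.pos⟩, h.2⟩
  tfae_have 2 → 1 := by
    rintro ⟨hbij, hpar, hnorm⟩
    obtain ⟨S, rfl⟩ := ParallelPairs.exists_equiv_of_injective hbij.1
    exact ParallelPairs.isometry_of_maps_facets hpoly hext S hT hnorm fun φ hφ =>
      ParallelPairs.maps_facets_of_preservesParallelPairs hpoly S hpar hφ
  tfae_have 4 → 1 := by
    rintro ⟨⟨ε, -, hεc, horth⟩, hnorm⟩
    have hT0 : T ≠ 0 := norm_ne_zero_iff.1 (by simp [hT])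
    obtain ⟨S, rfl⟩ := ParallelPairs.exists_equiv_of_injective
      (ParallelPairs.injective_of_preservesApproxOrth (hεc.trans hc.lt_one) hT0 horth)
    exact ParallelPairs.isometry_of_maps_facets hpoly hext S hT hnorm fun φ hφ =>
      ParallelPairs.maps_facets_of_preservesApproxOrth hpoly hc hεc S horth hφ
  tfae_finish
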